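/- Proposition. Let $d,n\ge 0$ and $T\ge 1$ be integers, $\mathcal Z$ a set, and $\ell:\mathbb R^d\times\mathcal Z\to\mathbb R$ a loss such that for every $z\in\mathcal Z$ the function $\ell(\cdot,z)$ is convex, differentiable, satisfies $\|\nabla_w\ell(w,z)\|_2\le G$ for all $w$, and has an $L$-Lipschitz gradient ($L\ge 0$). Let $\eta>0$ with $\eta L\le 2$, $\beta_0>0$, $\lambda_t=\frac1{t\eta}$, and $\alpha\in(1,\infty)$. Given a data set $S=(z_1,\dots,z_n)\in\mathcal Z^n$, single-pass SGLD (DP-SGD) draws $w_1\sim N(0,\beta_0 I)$ and then, for $t=2,\dots,T$, uses a mini-batch $B_t\subseteq\{1,\dots,n\}$ of size $$|B_t|=\left\lceil\sqrt{\frac{T}{2(T-t+1)}}\,\right\rceil$$ and samples $$w_t\sim N\Big((1-\lambda_t\eta)\Big(w_{t-1}-\frac{\eta}{|B_t|}\sum_{i\in B_t}\nabla_w\ell(w_{t-1},z_i)\Big),\ \lambda_t\eta(2-\lambda_t\eta)\beta_0 I\Big).$$ The mini-batches $B_2,\dots,B_T$ are pairwise disjoint (single pass); the sequence $(B_2,\dots,B_T)$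 is fixed or drawn at random from any distribution on such sequences, independently of the data and of the Gaussian noise. Then the last iterate $w_T$ is $(\alpha,\epsilon)$-Rényi differentially private with $$\epsilon=\frac{2\alpha\eta^2G^2}{\beta_0}.$$ That is, if $\mu_S$ denotes the law of $w_T$ on the data set $S$ (a probability measure), then $D_\alpha(\mu_S\|\mu_{S'})\le\epsilon$ for all $S,S'\in\mathcal Z^n$ that differ in at most one item, where $D_\alpha(\mu\|\nu)=\frac1{\alpha-1}\log\int\big(\frac{d\mu}{d\nu}\big)^\alpha d\nu$ if $\mu\ll\nu$ and $D_\alpha(\mu\|\nu)=\infty$ otherwise. -/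

import Mathlib

open MeasureTheory ProbabilityTheory
open scoped ENNReal NNReal

noncomputable section

namespace SGLD

/-- The isotropic Gaussian `N(m, v I)` on `ℝ^d`. -/
def gaussian {d : ℕ} (m : EuclideanSpace ℝ (Fin d)) (v : ℝ) :
    Measure (EuclideanSpace ℝ (Fin d)) :=
  multivariateGaussian m (v • (1 : Matrix (Fin d) (Fin d) ℝ))

/-- The mini-batch gradient `(1/|B|) ∑_{i ∈ B} ∇ℓ(w, z_i)`. -/
def batchGradient {d n : ℕ} {Z : Type*} (ℓ : EuclideanSpace ℝ (Fin d) → Z → ℝ)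
    (S : Fin n → Z) (B : Finset (Fin n)) (w : EuclideanSpace ℝ (Fin d)) :
    EuclideanSpace ℝ (Fin d) :=
  (B.card : ℝ)⁻¹ • ∑ i ∈ B, gradient (fun u => ℓ u (S i)) w

/-- One iteration: given the previous iterate `w`, the conditional law of the new iterate,
`N((1 - λη)(w - η g(w)), λη(2 - λη) β₀ I)`, where `g` is the gradient on the mini-batch `B`. -/
def stepLaw {d n : ℕ} {Z : Type*} (ℓ : EuclideanSpace ℝ (Fin d) → Z → ℝ)
    (S : Fin n → Z) (β₀ η lam : ℝ) (B : Finset (Fin n)) (w : EuclideanSpace ℝ (Fin d)) :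
    Measure (EuclideanSpace ℝ (Fin d)) :=
  gaussian ((1 - lam * η) • (w - η • batchGradient ℓ S B w))
    (lam * η * (2 - lam * η) * β₀)

/-- The law of the iterate `w_{k+1}` when iteration `t` uses step size `η t`, regularization
`lam t` and the mini-batch `M t`: `w_1 ~ N(0, β₀ I)`, and `w_t` is drawn from `w_{t-1}` by
iteration `t` for `t ≥ 2`. -/
def iterateLaw {d n : ℕ} {Z : Type*} (ℓ : EuclideanSpace ℝ (Fin d) → Z → ℝ)
    (S : Fin n → Z) (β₀ : ℝ) (η lam : ℕ → ℝ) (M : ℕ → Finset (Fin n)) :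
    ℕ → Measure (EuclideanSpace ℝ (Fin d))
  | 0 => gaussian 0 β₀
  | k + 1 => (iterateLaw ℓ S β₀ η lam M k).bind
      (stepLaw ℓ S β₀ (η (k + 2)) (lam (k + 2)) (M (k + 2)))

/-- A mini-batch schedule: a set of indices of data points for every iteration `t = 2, …, T`. -/
abbrev Schedule (T n : ℕ) : Type := Finset.Icc 2 T → Finset (Fin n)

/-- The mini-batch of iteration `t` (the value outside `2, …, T` is never used). -/
def Schedule.batch {T n : ℕ} (M : Schedule T n) (t : ℕ) : Finset (Fin n) :=
  if h : t ∈ Finset.Icc 2 T then M ⟨t, h⟩ else ∅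

/-- Single-pass schedules with the prescribed sizes: no data point is used in two iterations,
and the mini-batch of iteration `t` has `⌈√(T / (2 (T - t + 1)))⌉` elements. -/
def Schedule.IsSinglePass {T n : ℕ} (M : Schedule T n) : Prop :=
  (∀ s t, s ≠ t → Disjoint (M s) (M t)) ∧
  ∀ t : Finset.Icc 2 T,
    (M t).card = ⌈Real.sqrt ((T : ℝ) / (2 * ((T : ℝ) - ((t : ℕ) : ℝ) + 1)))⌉₊

/-- The law of the last iterate `w_T` on the data set `S`, when the mini-batch schedule is drawn
from `P`, independently of the data and of the Gaussian noise. -/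
def lastIterateLaw {d n : ℕ} {Z : Type*} (ℓ : EuclideanSpace ℝ (Fin d) → Z → ℝ)
    (β₀ : ℝ) (η lam : ℕ → ℝ) (T : ℕ) (P : PMF (Schedule T n)) (S : Fin n → Z) :
    Measure (EuclideanSpace ℝ (Fin d)) :=
  ∑ M : Schedule T n, P M • iterateLaw ℓ S β₀ η lam M.batch (T - 1)

open Classical in
/-- Rényi divergence of order `α`, for `1 < α < ∞`:
`(α - 1)⁻¹ log ∫ (dμ/dν)^α dν` if `μ ≪ ν`, and `∞` otherwise. -/
def renyiDiv {X : Type*} [MeasurableSpace X] (α : ℝ) (μ ν : Measure X) : EReal :=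
  if μ ≪ ν then
    (((α - 1)⁻¹ : ℝ) : EReal) * ENNReal.log (∫⁻ x, (μ.rnDeriv ν x) ^ α ∂ν)
  else ⊤

/-- Neighboring data sets: they differ in at most one item. -/
def Neighboring {n : ℕ} {Z : Type*} (S S' : Fin n → Z) : Prop :=
  {i | S i ≠ S' i}.ncard ≤ 1

/-- `(α, ε)`-Rényi differential privacy of a randomized algorithm on data sets of size `n`, given
by its output law on each data set. -/
def IsRenyiDP {n : ℕ} {Z X : Type*} [MeasurableSpace X] (α ε : ℝ)
    (A : (Fin n → Z) → Measure X) : Prop :=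
  (∀ S, IsProbabilityMeasure (A S)) ∧
  ∀ S S', Neighboring S S' → renyiDiv α (A S) (A S') ≤ (ε : EReal)

end SGLD

end

namespace SGLD

/-! ### Convex smooth functions: nonexpansive gradient steps -/

section Smooth

variable {E : Type*} [NormedAddCommGroup E] [InnerProductSpace ℝ E] [CompleteSpace E]

open scoped RealInnerProductSpace

/-! The divergence is bounded in dual form: with 1/r + 1/α = 1, the inequality ∫ f dμ ≤ K (∫ f^r
dν)^(1/r) for all f ≥ 0 forces ∫ (dμ/dν)^α dν ≤ K^α (`PowerDominated.lintegral_rnDeriv_rpow_le`).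
This form passes to mixtures with the same K (`PowerDominated.sum_smul`), so a fixed schedule
suffices, and it can be pulled back through a Markov chain step by step.

Let N = T - 1 and let the differing item enter between w_{k+1} and w_{k+2}; by the single pass it
enters nowhere else. Up to w_{k+1} the two laws coincide. After w_{k+2} both chains use the same
kernels, each a c-Lipschitz map with c = 1 - λη (gradient steps are nonexpansive by cocoercivity)
followed by Gaussian noise. Wang's power Harnack inequality survives such a step: noise of variance
v turns the constant V into V + v (`PowerHarnack.lintegral_gaussian`), and the contraction divides
it by c² (`PowerHarnack.step`). For λη = 1/t this telescopes to `remainingVariance`, V_k = β₀((N+1)²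
- (k+1)²)/(k+1)².

At the differing step both chains start from the same w and their means are at most 2cηG/b apart, b
being the batch size. The cost is 2(α-1)η²G²/β₀ times (k+1)²/(b²((N+1)² - (k+1)²)), and the
prescribed b makes the last factor at most 1 (`powerDominated_of_mem_batch`). -/

lemma hasDerivAt_comp_line {f : E → ℝ} (hf : Differentiable ℝ f) (x v : E) (t : ℝ) :
    HasDerivAt (fun t : ℝ => f (x + t • v)) ⟪gradient f (x + t • v), v⟫ t := by
  have h1 : HasDerivAt (fun t : ℝ => x + t • v) v t := by
    simpa using ((hasDerivAt_id t).smul_const v).const_add x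
  have h2 := (hf (x + t • v)).hasGradientAt.hasFDerivAt.comp_hasDerivAt t h1
  exact h2

/-- The tangent plane lies below the graph of a convex function. -/
lemma tangent_le_of_convexOn {f : E → ℝ} (hc : ConvexOn ℝ Set.univ f)
    (hf : Differentiable ℝ f) (x y : E) : f x + ⟪gradient f x, y - x⟫ ≤ f y := by
  have hd := hasDerivAt_comp_line hf x (y - x) 0
  have hc' : ConvexOn ℝ Set.univ (fun t : ℝ => f (x + t • (y - x))) := by
    have := hc.comp_affineMap (AffineMap.lineMap x y)
    refine (this.congr ?_)
    intro t _
    simp [AffineMap.lineMap_apply, add_comm]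
  have := hc'.le_slope_of_hasDerivAt (Set.mem_univ 0) (Set.mem_univ 1) one_pos hd
  simp [-inner_gradient_left, slope_def_field] at this
  linarith

/-- The descent lemma for functions with a Lipschitz gradient. -/
lemma le_quadratic_of_lipschitz_gradient {f : E → ℝ} {L : ℝ≥0} (hf : Differentiable ℝ f)
    (hL : LipschitzWith L (gradient f)) (x y : E) :
    f y ≤ f x + ⟪gradient f x, y - x⟫ + L / 2 * ‖y - x‖ ^ 2 := by
  set v := y - x with hv
  have hd : ∀ t : ℝ, HasDerivAt
      (fun t : ℝ => f (x + t • v) - t * ⟪gradient f x, v⟫ - L / 2 * ‖v‖ ^ 2 * t ^ 2)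
      (⟪gradient f (x + t • v), v⟫ - ⟪gradient f x, v⟫ - L / 2 * ‖v‖ ^ 2 * (2 * t)) t := by
    intro t
    have h1 := hasDerivAt_comp_line hf x v t
    have h2 := (hasDerivAt_id t).mul_const ⟪gradient f x, v⟫
    have h3 := (hasDerivAt_pow 2 t).const_mul (L / 2 * ‖v‖ ^ 2)
    have h4 := (h1.sub h2).sub h3
    simp only [one_mul, Nat.cast_ofNat, Nat.add_one_sub_one, pow_one] at h4
    exact h4
  have hanti := antitoneOn_of_hasDerivWithinAt_nonpos (convex_Icc (0 : ℝ) 1)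
    (fun t _ => (hd t).continuousAt.continuousWithinAt)
    (fun t _ => (hd t).hasDerivWithinAt) (by
      intro t ht
      rw [interior_Icc] at ht
      have h1 : ‖gradient f (x + t • v) - gradient f x‖ ≤ L * (t * ‖v‖) := by
        have := hL.dist_le_mul (x + t • v) x
        simpa [dist_eq_norm, norm_smul, abs_of_pos ht.1] using this
      have h2 := real_inner_le_norm (gradient f (x + t • v) - gradient f x) v
      rw [inner_sub_left] at h2
      have h3 := mul_le_mul_of_nonneg_right h1 (norm_nonneg v)
      nlinarith)
  have := hanti (Set.left_mem_Icc.2 zero_le_one) (Set.right_mem_Icc.2 zero_le_one) zero_le_one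
  simp [-inner_gradient_left, hv] at this
  simp only [hv]
  linarith

/-- Cocoercivity of the gradient of a convex smooth function. -/
lemma sq_norm_gradient_sub_le {f : E → ℝ} {L : ℝ≥0} (hc : ConvexOn ℝ Set.univ f)
    (hf : Differentiable ℝ f) (hL : LipschitzWith L (gradient f)) (x y : E) :
    ‖gradient f x - gradient f y‖ ^ 2 ≤ L * ⟪gradient f x - gradient f y, x - y⟫ := by
  rcases eq_or_ne L 0 with rfl | hL0
  · have := hL.dist_le_mul x y
    simp [dist_eq_norm] at this
    simp [this]
  have hLpos : (0 : ℝ) < L := by exact_mod_cast pos_iff_ne_zero.2 hL0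
  have key : ∀ x y : E, f x + ⟪gradient f x, y - x⟫
      + (2 * (L : ℝ))⁻¹ * ‖gradient f y - gradient f x‖ ^ 2 ≤ f y := by
    intro x y
    set g := gradient f y - gradient f x with hg
    -- The point y - g/L minimizes the gap between the quadratic upper bound at y and the tangent
    -- plane at x; that this gap is nonnegative is the claim.
    have h1 := tangent_le_of_convexOn hc hf x (y - (L : ℝ)⁻¹ • g)
    have h2 := le_quadratic_of_lipschitz_gradient hf hL y (y - (L : ℝ)⁻¹ • g)
    have e1 : y - (L : ℝ)⁻¹ • g - x = (y - x) - (L : ℝ)⁻¹ • g := by abel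
    have e2 : y - (L : ℝ)⁻¹ • g - y = - ((L : ℝ)⁻¹ • g) := by abel
    rw [e1, inner_sub_right, inner_smul_right] at h1
    rw [e2, inner_neg_right, inner_smul_right, norm_neg, norm_smul, mul_pow, norm_inv,
      Real.norm_of_nonneg hLpos.le] at h2
    have e3 : ⟪gradient f y, g⟫ - ⟪gradient f x, g⟫ = ‖g‖ ^ 2 := by
      rw [← inner_sub_left, real_inner_self_eq_norm_sq]
    have e4 : (L : ℝ) / 2 * ((L : ℝ)⁻¹ ^ 2 * ‖g‖ ^ 2) = (2 * (L : ℝ))⁻¹ * ‖g‖ ^ 2 := by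
      field_simp
    have e5 : (L : ℝ)⁻¹ * ⟪gradient f y, g⟫ - (L : ℝ)⁻¹ * ⟪gradient f x, g⟫
        = 2 * ((2 * (L : ℝ))⁻¹ * ‖g‖ ^ 2) := by
      rw [← mul_sub, e3]; field_simp
    linarith
  have h1 := key x y
  have h2 := key y x
  rw [norm_sub_rev] at h1
  have e : ⟪gradient f x, y - x⟫ + ⟪gradient f y, x - y⟫
      = - ⟪gradient f x - gradient f y, x - y⟫ := by
    rw [← neg_sub x y, inner_neg_right, inner_sub_left]; ring
  have h3 : (L : ℝ)⁻¹ * ‖gradient f x - gradient f y‖ ^ 2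
      ≤ ⟪gradient f x - gradient f y, x - y⟫ := by
    have : (L : ℝ)⁻¹ = (2 * (L : ℝ))⁻¹ + (2 * (L : ℝ))⁻¹ := by field_simp; norm_num
    rw [this]; linarith
  rwa [inv_mul_le_iff₀ hLpos] at h3

/-- A gradient step of size `η ≤ 2 / L` on a convex `L`-smooth function is nonexpansive. -/
lemma norm_gradient_step_sub_le {f : E → ℝ} {L : ℝ≥0} (hc : ConvexOn ℝ Set.univ f)
    (hf : Differentiable ℝ f) (hL : LipschitzWith L (gradient f)) {η : ℝ} (hη : 0 < η)
    (hηL : η * L ≤ 2) (x y : E) :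
    ‖(x - η • gradient f x) - (y - η • gradient f y)‖ ≤ ‖x - y‖ := by
  have e : (x - η • gradient f x) - (y - η • gradient f y)
      = (x - y) - η • (gradient f x - gradient f y) := by rw [smul_sub]; abel
  have h := sq_norm_gradient_sub_le hc hf hL x y
  have h0 : 0 ≤ ⟪gradient f x - gradient f y, x - y⟫ := by
    have h1 := tangent_le_of_convexOn hc hf x y
    have h2 := tangent_le_of_convexOn hc hf y x
    rw [← neg_sub x y, inner_neg_right] at h1
    rw [inner_sub_left]; linarith
  rw [← sq_le_sq₀ (norm_nonneg _) (norm_nonneg _), e, norm_sub_sq_real, inner_smul_right,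
    norm_smul, mul_pow, Real.norm_of_nonneg hη.le, real_inner_comm]
  -- With Δ the gradient difference, η²‖Δ‖² ≤ η²L⟨Δ, x - y⟩ ≤ 2η⟨Δ, x - y⟩, which the cross term
  -- absorbs.
  nlinarith [mul_le_mul_of_nonneg_left h (sq_nonneg η),
    mul_le_mul_of_nonneg_right hηL (mul_nonneg hη.le h0)]

end Smooth

/-! ### Mini-batch gradients -/

section Batch

variable {d n : ℕ} {Z : Type*} {ℓ : EuclideanSpace ℝ (Fin d) → Z → ℝ}

/-- A nonempty mini-batch step is the average of the single-item gradient steps, each nonexpansive;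
for an empty batch the gradient is 0 and the step is the identity. -/
lemma norm_batch_step_sub_le {L : ℝ≥0}
    (hconv : ∀ z, ConvexOn ℝ Set.univ (fun w => ℓ w z))
    (hdiff : ∀ z, Differentiable ℝ (fun w => ℓ w z))
    (hL : ∀ z, LipschitzWith L (gradient (fun w => ℓ w z))) {η : ℝ}
    (hη : 0 < η) (hηL : η * L ≤ 2) (S : Fin n → Z) (B : Finset (Fin n))
    (x y : EuclideanSpace ℝ (Fin d)) :
    ‖(x - η • batchGradient ℓ S B x) - (y - η • batchGradient ℓ S B y)‖ ≤ ‖x - y‖ := by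
  rcases B.eq_empty_or_nonempty with rfl | hB
  · simp [batchGradient]
  have hc : (0 : ℝ) < B.card := by exact_mod_cast hB.card_pos
  have e : ∀ w : EuclideanSpace ℝ (Fin d), w - η • batchGradient ℓ S B w
      = (B.card : ℝ)⁻¹ • ∑ i ∈ B, (w - η • gradient (fun u => ℓ u (S i)) w) := by
    intro w
    rw [Finset.sum_sub_distrib, ← Finset.smul_sum, smul_sub, batchGradient,
      smul_comm, Finset.sum_const, ← Nat.cast_smul_eq_nsmul ℝ, inv_smul_smul₀ hc.ne']
  rw [e, e, ← smul_sub, ← Finset.sum_sub_distrib, norm_smul, norm_inv,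
    Real.norm_of_nonneg hc.le, inv_mul_le_iff₀ hc]
  refine (norm_sum_le_of_le B fun i _ =>
    norm_gradient_step_sub_le (hconv _) (hdiff _) (hL _) hη hηL x y).trans ?_
  simp

lemma continuous_batchGradient {L : ℝ≥0}
    (hL : ∀ z, LipschitzWith L (gradient (fun w => ℓ w z))) (S : Fin n → Z)
    (B : Finset (Fin n)) : Continuous (batchGradient ℓ S B) := by
  have := continuous_finsetSum B fun i _ => (hL (S i)).continuous
  exact this.const_smul (B.card : ℝ)⁻¹

lemma batchGradient_congr {S S' : Fin n → Z} {B : Finset (Fin n)} (h : ∀ i ∈ B, S i = S' i) :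
    batchGradient ℓ S B = batchGradient ℓ S' B := by
  funext w
  unfold batchGradient
  rw [Finset.sum_congr rfl fun i hi => by rw [h i hi]]

/-- The sensitivity of the mini-batch gradient to a change of a single data point. -/
lemma norm_batchGradient_sub_le {G : ℝ} (hG : ∀ w z, ‖gradient (fun u => ℓ u z) w‖ ≤ G)
    {S S' : Fin n → Z} {i : Fin n} (h : ∀ j, j ≠ i → S j = S' j) (B : Finset (Fin n))
    (w : EuclideanSpace ℝ (Fin d)) :
    ‖batchGradient ℓ S B w - batchGradient ℓ S' B w‖ ≤ (B.card : ℝ)⁻¹ * (2 * G) := by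
  unfold batchGradient
  rw [← smul_sub, ← Finset.sum_sub_distrib, norm_smul, norm_inv, Real.norm_natCast]
  refine mul_le_mul_of_nonneg_left ?_ (by positivity)
  have hG0 : 0 ≤ G := (norm_nonneg _).trans (hG w (S i))
  by_cases hi : i ∈ B
  · rw [Finset.sum_eq_single_of_mem i hi fun j _ hj => by rw [h j hj, sub_self]]
    refine (norm_sub_le _ _).trans ?_
    linarith [hG w (S i), hG w (S' i)]
  · rw [Finset.sum_eq_zero fun j hj => by
      rw [h j (fun e => hi (e ▸ hj)), sub_self]]
    simpa using hG0

end Batch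

/-! ### Gaussian shifts and power Harnack inequalities -/

section Gaussian

open scoped RealInnerProductSpace MatrixOrder

lemma gaussianReal_eq_withDensity_exp (h : ℝ) :
    gaussianReal h 1 = (gaussianReal 0 1).withDensity
      (fun x => ENNReal.ofReal (Real.exp (h * x - h ^ 2 / 2))) := by
  rw [gaussianReal_of_var_ne_zero _ one_ne_zero, gaussianReal_of_var_ne_zero _ one_ne_zero,
    ← withDensity_mul _ (measurable_gaussianPDF _ _) (by fun_prop)]
  congr 1
  ext x
  simp only [Pi.mul_apply, gaussianPDF, gaussianPDFReal]
  rw [← ENNReal.ofReal_mul (by positivity), mul_assoc (√_)⁻¹, ← Real.exp_add]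
  congr 3
  simp
  ring

lemma pi_gaussianReal_eq_withDensity {ι : Type*} [Fintype ι] (h : ι → ℝ) :
    Measure.pi (fun i => gaussianReal (h i) 1) =
      (Measure.pi fun _ : ι => gaussianReal 0 1).withDensity
      (fun x => ∏ i, ENNReal.ofReal (Real.exp (h i * x i - h i ^ 2 / 2))) := by
  refine Measure.pi_eq fun s hs => ?_
  rw [withDensity_apply _ (MeasurableSet.univ_pi hs),
    ← lintegral_indicator (MeasurableSet.univ_pi hs)]
  have hm : ∀ i, Measurable ((s i).indicator
      fun x => ENNReal.ofReal (Real.exp (h i * x - h i ^ 2 / 2))) :=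
    fun i => Measurable.indicator (by fun_prop) (hs i)
  have e : ∀ x : ι → ℝ, (Set.univ.pi s).indicator
      (fun x => ∏ i, ENNReal.ofReal (Real.exp (h i * x i - h i ^ 2 / 2))) x
      = ∏ i, (s i).indicator (fun x => ENNReal.ofReal (Real.exp (h i * x - h i ^ 2 / 2))) (x i) := by
    intro x
    by_cases hx : x ∈ Set.univ.pi s
    · rw [Set.indicator_of_mem hx]
      exact Finset.prod_congr rfl fun i _ => by
        rw [Set.indicator_of_mem (hx i (Set.mem_univ i))]
    · rw [Set.indicator_of_notMem hx]
      obtain ⟨i, hi⟩ : ∃ i, x i ∉ s i := by simpa [Set.mem_pi] using hx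
      exact (Finset.prod_eq_zero (Finset.mem_univ i) (Set.indicator_of_notMem hi _)).symm
  simp_rw [e]
  have hind := iIndepFun_pi (μ := fun _ : ι => gaussianReal 0 1) fun i => (hm i).aemeasurable
  rw [lintegral_prod_eq_prod_lintegral_of_indepFun _ _ hind
    fun i => (hm i).comp (measurable_pi_apply i)]
  refine Finset.prod_congr rfl fun i _ => ?_
  rw [(measurePreserving_eval (fun _ : ι => gaussianReal 0 1) i).lintegral_comp (hm i),
    lintegral_indicator (hs i), gaussianReal_eq_withDensity_exp (h i), withDensity_apply _ (hs i)]

variable {d : ℕ}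

/-- The Cameron–Martin formula for the standard Gaussian measure. -/
lemma lintegral_stdGaussian_add (h : EuclideanSpace ℝ (Fin d))
    {f : EuclideanSpace ℝ (Fin d) → ℝ≥0∞}
    (hf : Measurable f) :
    ∫⁻ x, f (h + x) ∂stdGaussian (EuclideanSpace ℝ (Fin d))
      = ∫⁻ x, ENNReal.ofReal (Real.exp (⟪h, x⟫ - ‖h‖ ^ 2 / 2)) * f x
          ∂stdGaussian (EuclideanSpace ℝ (Fin d)) := by
  have hshift : (Measure.pi fun _ : Fin d => gaussianReal 0 1).map (fun x => h.ofLp + x)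
      = Measure.pi fun i => gaussianReal (h i) 1 := by
    have := Measure.pi_map_pi (μ := fun _ : Fin d => gaussianReal 0 1)
      (f := fun i x => h i + x) fun i => by fun_prop
    rw [show (fun x : Fin d → ℝ => h.ofLp + x) = fun x i => h i + x i from rfl, this]
    congr 1
    ext1 i
    rw [gaussianReal_map_const_add, zero_add]
  rw [← map_pi_eq_stdGaussian, lintegral_map (by fun_prop) (by fun_prop),
    lintegral_map (by fun_prop) (by fun_prop)]
  calc ∫⁻ x, f (h + WithLp.toLp 2 x) ∂(Measure.pi fun _ : Fin d => gaussianReal 0 1)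
      = ∫⁻ x, f (WithLp.toLp 2 x) ∂(Measure.pi fun i => gaussianReal (h i) 1) := by
        rw [← hshift, lintegral_map (by fun_prop) (by fun_prop)]
        rfl
    _ = _ := by
        rw [pi_gaussianReal_eq_withDensity, lintegral_withDensity_eq_lintegral_mul _
          (by fun_prop) (by fun_prop)]
        refine lintegral_congr fun x => ?_
        rw [Pi.mul_apply, ← ENNReal.ofReal_prod_of_nonneg fun i _ => (Real.exp_pos _).le,
          ← Real.exp_sum]
        congr 3
        rw [Finset.sum_sub_distrib, EuclideanSpace.real_norm_sq_eq, Finset.sum_div]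
        simp [PiLp.inner_apply, mul_comm]

/-- Cameron–Martin applied to a constant function: the shifted density has total mass 1. -/
lemma lintegral_exp_inner_stdGaussian (h : EuclideanSpace ℝ (Fin d)) (c : ℝ) :
    ∫⁻ x, ENNReal.ofReal (Real.exp (⟪h, x⟫ + c)) ∂stdGaussian (EuclideanSpace ℝ (Fin d))
      = ENNReal.ofReal (Real.exp (‖h‖ ^ 2 / 2 + c)) := by
  have h1 := lintegral_stdGaussian_add h (f := fun _ => ENNReal.ofReal (Real.exp (‖h‖ ^ 2 / 2 + c)))
    measurable_const
  simp only [lintegral_const, measure_univ, mul_one] at h1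
  rw [h1]
  refine lintegral_congr fun x => ?_
  rw [← ENNReal.ofReal_mul (Real.exp_pos _).le, ← Real.exp_add]
  congr 2
  ring

lemma gaussian_eq_map (m : EuclideanSpace ℝ (Fin d)) {v : ℝ} (hv : 0 ≤ v) :
    gaussian m v = (stdGaussian (EuclideanSpace ℝ (Fin d))).map fun x => m + √v • x := by
  have hs : CFC.sqrt (v • (1 : Matrix (Fin d) (Fin d) ℝ)) = √v • 1 := by
    refine CFC.sqrt_unique ?_ ?_
    · rw [smul_mul_smul_comm, Real.mul_self_sqrt hv, one_mul]
    · exact smul_nonneg (Real.sqrt_nonneg v) zero_le_one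
  rw [gaussian, multivariateGaussian, hs]
  congr 1
  ext1 x
  simp

instance isProbabilityMeasure_gaussian (m : EuclideanSpace ℝ (Fin d)) (v : ℝ) :
    IsProbabilityMeasure (gaussian m v) := by
  unfold gaussian; infer_instance

lemma lintegral_gaussian (m : EuclideanSpace ℝ (Fin d)) {v : ℝ} (hv : 0 ≤ v)
    {f : EuclideanSpace ℝ (Fin d) → ℝ≥0∞} (hf : Measurable f) :
    ∫⁻ x, f x ∂gaussian m v = ∫⁻ x, f (m + √v • x) ∂stdGaussian (EuclideanSpace ℝ (Fin d)) := by
  rw [gaussian_eq_map m hv, lintegral_map hf (by fun_prop)]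

lemma lintegral_gaussian_add (m b : EuclideanSpace ℝ (Fin d)) {v : ℝ} (hv : 0 ≤ v)
    {f : EuclideanSpace ℝ (Fin d) → ℝ≥0∞} (hf : Measurable f) :
    ∫⁻ x, f (x + b) ∂gaussian m v = ∫⁻ x, f x ∂gaussian (m + b) v := by
  rw [lintegral_gaussian _ hv (by fun_prop), lintegral_gaussian _ hv hf]
  refine lintegral_congr fun x => ?_
  rw [add_right_comm]

/-- Wang's power Harnack inequality for a Gaussian convolution. -/
lemma lintegral_gaussian_le_rpow {α r : ℝ} (hr : r.HolderConjugate α)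
    (p q : EuclideanSpace ℝ (Fin d)) {v : ℝ} (hv : 0 < v)
    {f : EuclideanSpace ℝ (Fin d) → ℝ≥0∞} (hf : Measurable f) :
    ∫⁻ x, f x ∂gaussian p v ≤ ENNReal.ofReal (Real.exp ((α - 1) / 2 * (‖p - q‖ ^ 2 / v)))
      * (∫⁻ x, f x ^ r ∂gaussian q v) ^ (1 / r) := by
  have hα : 0 < α := hr.symm.pos
  set h := (√v)⁻¹ • (p - q) with hh
  have hsv : √v ≠ 0 := (Real.sqrt_pos.2 hv).ne'
  have hp : ∀ x, p + √v • x = q + √v • (h + x) := by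
    intro x
    rw [smul_add, hh, smul_inv_smul₀ hsv]; abel
  have hn : ‖h‖ ^ 2 = ‖p - q‖ ^ 2 / v := by
    rw [hh, norm_smul, mul_pow, norm_inv, Real.norm_of_nonneg (Real.sqrt_nonneg v), inv_pow,
      Real.sq_sqrt hv.le, div_eq_inv_mul]
  rw [lintegral_gaussian _ hv.le hf, lintegral_gaussian _ hv.le (by fun_prop)]
  simp_rw [hp]
  rw [lintegral_stdGaussian_add h (f := fun x => f (q + √v • x)) (by fun_prop), mul_comm]
  -- Hölder separates f from the Cameron–Martin density, whose L^α norm is exp((α - 1)‖h‖²/2).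
  have hH := ENNReal.lintegral_mul_le_Lp_mul_Lq (stdGaussian (EuclideanSpace ℝ (Fin d))) hr
    (f := fun x => f (q + √v • x))
    (g := fun x => ENNReal.ofReal (Real.exp (⟪h, x⟫ - ‖h‖ ^ 2 / 2)))
    (by fun_prop) (by fun_prop)
  simp only [Pi.mul_apply] at hH
  simp_rw [mul_comm (ENNReal.ofReal _) (f _)]
  refine hH.trans (le_of_eq ?_)
  congr 1
  have e : ∀ x : EuclideanSpace ℝ (Fin d),
      ENNReal.ofReal (Real.exp (⟪h, x⟫ - ‖h‖ ^ 2 / 2)) ^ α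
      = ENNReal.ofReal (Real.exp (⟪α • h, x⟫ + (-(α * (‖h‖ ^ 2 / 2))))) := by
    intro x
    rw [ENNReal.ofReal_rpow_of_pos (Real.exp_pos _), ← Real.exp_mul, real_inner_smul_left h]
    congr 2
    ring
  simp_rw [e]
  rw [lintegral_exp_inner_stdGaussian, ENNReal.ofReal_rpow_of_pos (Real.exp_pos _), ← Real.exp_mul,
    norm_smul, Real.norm_of_nonneg hα.le, ← hn]
  congr 2
  field_simp
  ring

/-- `F` is bounded by the `r`-th root of `Φ` at a cost that is Gaussian in the distance; for
`V = 0` only on the diagonal. -/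
def PowerHarnack (α r V : ℝ) (F Φ : EuclideanSpace ℝ (Fin d) → ℝ≥0∞) : Prop :=
  ∀ x y, (V = 0 → x = y) →
    F x ≤ ENNReal.ofReal (Real.exp ((α - 1) / 2 * (‖x - y‖ ^ 2 / V))) * Φ y ^ (1 / r)

/-- Averaging over a Gaussian of variance `v` improves the constant from `V` to `V + v`. -/
lemma PowerHarnack.lintegral_gaussian {α r V v : ℝ} (hr : r.HolderConjugate α) (hV : 0 ≤ V)
    (hv : 0 < v) {F Φ : EuclideanSpace ℝ (Fin d) → ℝ≥0∞}
    (hΦ : Measurable Φ) (h : PowerHarnack α r V F Φ) (p q : EuclideanSpace ℝ (Fin d)) :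
    ∫⁻ x, F x ∂gaussian p v
      ≤ ENNReal.ofReal (Real.exp ((α - 1) / 2 * (‖p - q‖ ^ 2 / (V + v))))
        * (∫⁻ x, Φ x ∂gaussian q v) ^ (1 / r) := by
  -- Of the displacement q - p, the fraction θ is left to the later dynamics (cost over V) and 1 - θ
  -- is paid by the present noise (cost over v). This θ minimizes the total, giving ‖p - q‖²/(V +
  -- v); for V = 0 it is 0, as the diagonal condition requires.
  set θ := V / (V + v) with hθ
  set b := θ • (q - p) with hb
  have hVv : 0 < V + v := by linarith
  have h1 : ∀ x, F x ≤ ENNReal.ofReal (Real.exp ((α - 1) / 2 * (‖b‖ ^ 2 / V)))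
      * Φ (x + b) ^ (1 / r) := by
    intro x
    have := h x (x + b) (by intro h0; simp [hb, hθ, h0])
    simpa using this
  have hm : Measurable fun x => Φ x ^ (1 / r) := hΦ.pow_const _
  calc ∫⁻ x, F x ∂gaussian p v
      ≤ ∫⁻ x, ENNReal.ofReal (Real.exp ((α - 1) / 2 * (‖b‖ ^ 2 / V))) * Φ (x + b) ^ (1 / r)
          ∂gaussian p v := lintegral_mono h1
    _ = ENNReal.ofReal (Real.exp ((α - 1) / 2 * (‖b‖ ^ 2 / V)))
          * ∫⁻ x, Φ x ^ (1 / r) ∂gaussian (p + b) v := by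
        rw [lintegral_const_mul _ (by fun_prop), lintegral_gaussian_add p b hv.le hm]
    _ ≤ ENNReal.ofReal (Real.exp ((α - 1) / 2 * (‖b‖ ^ 2 / V)))
          * (ENNReal.ofReal (Real.exp ((α - 1) / 2 * (‖p + b - q‖ ^ 2 / v)))
          * (∫⁻ x, (Φ x ^ (1 / r)) ^ r ∂gaussian q v) ^ (1 / r)) := by
        gcongr
        exact lintegral_gaussian_le_rpow hr _ _ hv hm
    _ = _ := by
        rw [← mul_assoc, ← ENNReal.ofReal_mul (Real.exp_pos _).le, ← Real.exp_add]
        have e1 : ‖b‖ ^ 2 / V = V / (V + v) ^ 2 * ‖p - q‖ ^ 2 := by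
          rw [hb, norm_smul, mul_pow, Real.norm_eq_abs, sq_abs, norm_sub_rev, hθ]
          rcases eq_or_ne V 0 with h0 | h0
          · simp [h0]
          · field_simp
        have e2 : ‖p + b - q‖ ^ 2 / v = v / (V + v) ^ 2 * ‖p - q‖ ^ 2 := by
          have : p + b - q = (v / (V + v)) • (p - q) := by
            have hθ' : v / (V + v) = 1 - θ := by rw [hθ]; field_simp; ring
            rw [hθ', hb, sub_smul, one_smul, smul_sub, smul_sub]; abel
          rw [this, norm_smul, mul_pow, Real.norm_eq_abs, sq_abs]
          field_simp
        rw [e1, e2]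
        congr 4
        · field_simp
        · simp [ENNReal.rpow_inv_rpow hr.pos.ne']

end Gaussian

/-! ### Rényi divergence by duality -/

section Renyi

variable {X : Type*} [MeasurableSpace X]

/-- The functional form of a bound on the Rényi divergence: integrals against `μ` are bounded by
`K` times the `L^r` norm with respect to `ν`. -/
def PowerDominated (r : ℝ) (K : ℝ≥0∞) (μ ν : Measure X) : Prop :=
  ∀ f : X → ℝ≥0∞, Measurable f → ∫⁻ x, f x ∂μ ≤ K * (∫⁻ x, f x ^ r ∂ν) ^ (1 / r)

lemma PowerDominated.absolutelyContinuous {r : ℝ} (hr : 0 < r) {K : ℝ≥0∞} {μ ν : Measure X}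
    (h : PowerDominated r K μ ν) : μ ≪ ν := by
  refine Measure.AbsolutelyContinuous.mk fun s hs hν => ?_
  have e : ∀ x, (s.indicator (1 : X → ℝ≥0∞) x) ^ r = s.indicator 1 x := by
    intro x
    by_cases hx : x ∈ s <;> simp [hx, hr]
  have := h _ (measurable_one.indicator hs)
  simp_rw [e] at this
  rw [lintegral_indicator_one hs, lintegral_indicator_one hs, hν,
    ENNReal.zero_rpow_of_pos (by positivity), mul_zero] at this
  exact le_antisymm this zero_le

/-- Converse Hölder: testing with g^(α-1), g = dμ/dν, gives I ≤ K I^(1/r) for I = ∫ g^α dν.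
Truncating g at n keeps I finite, so that I^(1/r) may be cancelled; monotone convergence removes the
truncation. -/
lemma PowerDominated.lintegral_rnDeriv_rpow_le {α r : ℝ} (hr : r.HolderConjugate α) {K : ℝ≥0∞}
    {μ ν : Measure X} [IsFiniteMeasure μ] [IsFiniteMeasure ν] (h : PowerDominated r K μ ν) :
    ∫⁻ x, μ.rnDeriv ν x ^ α ∂ν ≤ K ^ α := by
  have hα : 0 < α := hr.symm.pos
  have hα1 : 0 < α - 1 := sub_pos.2 hr.symm.lt
  have hac := h.absolutelyContinuous hr.pos
  have hgm : Measurable (μ.rnDeriv ν) := Measure.measurable_rnDeriv μ ν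
  have key : ∀ n : ℕ, ∫⁻ x, (min (μ.rnDeriv ν x) n) ^ α ∂ν ≤ K ^ α := by
    intro n
    set I := ∫⁻ x, (min (μ.rnDeriv ν x) n) ^ α ∂ν with hI
    have hItop : I ≠ ∞ := by
      refine ne_top_of_le_ne_top ?_ (lintegral_mono (g := fun _ => (n : ℝ≥0∞) ^ α) fun x =>
        ENNReal.rpow_le_rpow (min_le_right _ _) hα.le)
      rw [lintegral_const]
      exact ENNReal.mul_ne_top (ENNReal.rpow_ne_top_of_nonneg hα.le (ENNReal.natCast_ne_top n))
        (measure_ne_top _ _)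
    have h1 : I ≤ K * I ^ (1 / r) := by
      have h2 := h (fun x => (min (μ.rnDeriv ν x) n) ^ (α - 1)) (by fun_prop)
      have h3 : ∀ x, ((min (μ.rnDeriv ν x) n) ^ (α - 1)) ^ r = (min (μ.rnDeriv ν x) n) ^ α := by
        intro x
        rw [← ENNReal.rpow_mul, hr.symm.sub_one_mul_conj]
      simp_rw [h3] at h2
      refine le_trans ?_ h2
      rw [← lintegral_rnDeriv_mul hac (by fun_prop)]
      refine lintegral_mono fun x => ?_
      calc (min (μ.rnDeriv ν x) n) ^ α
          = (min (μ.rnDeriv ν x) n) ^ (1 : ℝ) * (min (μ.rnDeriv ν x) n) ^ (α - 1) := by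
            rw [← ENNReal.rpow_add_of_nonneg _ _ zero_le_one hα1.le]; ring_nf
        _ ≤ _ := by
            rw [ENNReal.rpow_one]
            gcongr
            exact min_le_left _ _
    rcases eq_or_ne I 0 with h0 | h0
    · rw [h0]; exact zero_le
    have e : I = I ^ (1 / α) * I ^ (1 / r) := by
      rw [← ENNReal.rpow_add _ _ h0 hItop, one_div, one_div, hr.symm.inv_add_inv_eq_one,
        ENNReal.rpow_one]
    have h4 : I ^ (1 / α) ≤ K := by
      refine (ENNReal.mul_le_mul_iff_left (c := I ^ (1 / r)) ?_ ?_).1 ?_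
      · exact (ENNReal.rpow_pos (pos_iff_ne_zero.2 h0) hItop).ne'
      · exact ENNReal.rpow_ne_top_of_nonneg (one_div_nonneg.2 hr.nonneg) hItop
      · rwa [← e]
    calc I = (I ^ (1 / α)) ^ α := by rw [one_div, ENNReal.rpow_inv_rpow hα.ne']
      _ ≤ K ^ α := ENNReal.rpow_le_rpow h4 hα.le
  have hlim := lintegral_tendsto_of_tendsto_of_monotone (μ := ν)
    (f := fun (n : ℕ) x => (min (μ.rnDeriv ν x) n) ^ α) (F := fun x => μ.rnDeriv ν x ^ α)
    (fun n => by fun_prop)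
    (Filter.Eventually.of_forall fun x m n hmn => by
      dsimp only
      gcongr)
    (by
      filter_upwards [μ.rnDeriv_lt_top ν] with x hx
      obtain ⟨N, hN⟩ := ENNReal.exists_nat_gt hx.ne
      refine tendsto_const_nhds.congr' ?_
      filter_upwards [Filter.eventually_ge_atTop N] with n hn
      rw [min_eq_left (hN.le.trans (by exact_mod_cast hn))])
  exact le_of_tendsto' hlim key

/-- The constant is normalized so that its α-th power is exp((α - 1)ε). -/
lemma PowerDominated.renyiDiv_le {α r ε : ℝ} (hr : r.HolderConjugate α)
    {μ ν : Measure X} [IsFiniteMeasure μ] [IsFiniteMeasure ν]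
    (h : PowerDominated r (ENNReal.ofReal (Real.exp ((α - 1) / α * ε))) μ ν) :
    renyiDiv α μ ν ≤ ε := by
  have hα : 0 < α := hr.symm.pos
  have hα1 : 0 < α - 1 := sub_pos.2 hr.symm.lt
  rw [renyiDiv, if_pos (h.absolutelyContinuous hr.pos)]
  have h1 := h.lintegral_rnDeriv_rpow_le hr
  rw [ENNReal.ofReal_rpow_of_pos (Real.exp_pos _), ← Real.exp_mul] at h1
  have h2 := ENNReal.log_le_log h1
  rw [ENNReal.log_ofReal_of_pos (Real.exp_pos _), Real.log_exp] at h2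
  calc (((α - 1)⁻¹ : ℝ) : EReal) * ENNReal.log (∫⁻ x, (μ.rnDeriv ν x) ^ α ∂ν)
      ≤ (((α - 1)⁻¹ : ℝ) : EReal) * (((α - 1) / α * ε * α : ℝ) : EReal) :=
        mul_le_mul_of_nonneg_left h2 (by exact_mod_cast (inv_pos.2 hα1).le)
    _ = (ε : EReal) := by
        rw [← EReal.coe_mul]
        congr 1
        field_simp

/-- Jensen's inequality for the `r`-th root. -/
lemma lintegral_rpow_inv_le {α r : ℝ} (hr : r.HolderConjugate α) (μ : Measure X)
    [IsProbabilityMeasure μ] {f : X → ℝ≥0∞} (hf : Measurable f) :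
    ∫⁻ x, f x ^ (1 / r) ∂μ ≤ (∫⁻ x, f x ∂μ) ^ (1 / r) := by
  have h := ENNReal.lintegral_mul_le_Lp_mul_Lq μ hr (f := fun x => f x ^ (1 / r)) (g := fun _ => 1)
    (by fun_prop) (by fun_prop)
  simpa [ENNReal.rpow_inv_rpow hr.pos.ne'] using h

lemma powerDominated_self {α r : ℝ} (hr : r.HolderConjugate α) {K : ℝ≥0∞} (hK : 1 ≤ K)
    (μ : Measure X) [IsProbabilityMeasure μ] : PowerDominated r K μ μ := by
  intro f hf
  have h := lintegral_rpow_inv_le hr μ (f := fun x => f x ^ r) (by fun_prop)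
  simp only [one_div, ENNReal.rpow_rpow_inv hr.pos.ne'] at h ⊢
  exact h.trans (le_mul_of_one_le_left zero_le hK)

/-- Quasi-convexity: a mixture of dominated pairs is dominated. -/
lemma PowerDominated.sum_smul {α r : ℝ} (hr : r.HolderConjugate α) {K : ℝ≥0∞} {ι : Type*}
    [Fintype ι] {p : ι → ℝ≥0∞} (hp : ∑ i, p i = 1) {μ ν : ι → Measure X}
    (h : ∀ i, p i ≠ 0 → PowerDominated r K (μ i) (ν i)) :
    PowerDominated r K (∑ i, p i • μ i) (∑ i, p i • ν i) := by
  intro f hf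
  simp only [lintegral_finsetSum_measure, lintegral_smul_measure, smul_eq_mul]
  -- Each weight is split as p^(1/r) · p^(1/α); the second factors have ℓ^α norm 1, so the constant
  -- does not grow.
  have h1 := ENNReal.inner_le_Lp_mul_Lq Finset.univ
    (fun i => (p i * ∫⁻ x, f x ^ r ∂ν i) ^ (1 / r)) (fun i => p i ^ (1 / α)) hr
  simp only [one_div, ENNReal.rpow_inv_rpow hr.pos.ne', ENNReal.rpow_inv_rpow hr.symm.pos.ne', hp,
    ENNReal.one_rpow, mul_one] at h1
  rw [one_div]
  refine le_trans ?_ (mul_le_mul_right h1 K)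
  rw [Finset.mul_sum]
  refine Finset.sum_le_sum fun i _ => ?_
  rcases eq_or_ne (p i) 0 with h0 | h0
  · simp [h0]
  have e : p i = p i ^ r⁻¹ * p i ^ α⁻¹ := by
    rw [← ENNReal.rpow_add_of_nonneg _ _ (inv_nonneg.2 hr.nonneg) (inv_nonneg.2 hr.symm.nonneg),
      hr.inv_add_inv_eq_one, ENNReal.rpow_one]
  rw [ENNReal.mul_rpow_of_nonneg _ _ (inv_nonneg.2 hr.nonneg)]
  calc p i * ∫⁻ x, f x ∂μ i
      ≤ p i * (K * (∫⁻ x, f x ^ r ∂ν i) ^ (1 / r)) := by gcongr; exact h i h0 f hf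
    _ = (p i ^ r⁻¹ * p i ^ α⁻¹) * (K * (∫⁻ x, f x ^ r ∂ν i) ^ (1 / r)) := by rw [← e]
    _ = _ := by rw [one_div]; ring

end Renyi

/-! ### The SGLD chain and its backward analysis -/

section Dynamics

variable {d n : ℕ} {Z : Type*} {ℓ : EuclideanSpace ℝ (Fin d) → Z → ℝ}

lemma measurable_gaussian {m : EuclideanSpace ℝ (Fin d) → EuclideanSpace ℝ (Fin d)}
    (hm : Measurable m) {v : ℝ} (hv : 0 ≤ v) : Measurable fun w => gaussian (m w) v := by
  refine Measure.measurable_of_measurable_coe _ fun s hs => ?_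
  have e : ∀ w, gaussian (m w) v s
      = ∫⁻ x, s.indicator 1 (m w + √v • x) ∂stdGaussian (EuclideanSpace ℝ (Fin d)) := by
    intro w
    rw [← lintegral_gaussian _ hv (measurable_one.indicator hs), lintegral_indicator_one hs]
  simp_rw [e]
  have h1 : Measurable fun p : EuclideanSpace ℝ (Fin d) × EuclideanSpace ℝ (Fin d) =>
      m p.1 + √v • p.2 := by fun_prop
  exact ((measurable_one.indicator hs).comp h1).lintegral_prod_right'

lemma measurable_stepLaw {S : Fin n → Z} {B : Finset (Fin n)}
    (hc : Continuous (batchGradient ℓ S B)) {β₀ η lam : ℝ}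
    (hv : 0 ≤ lam * η * (2 - lam * η) * β₀) : Measurable (stepLaw ℓ S β₀ η lam B) :=
  measurable_gaussian (by fun_prop) hv

lemma isProbabilityMeasure_stepLaw (S : Fin n → Z) (β₀ η lam : ℝ) (B : Finset (Fin n))
    (w : EuclideanSpace ℝ (Fin d)) : IsProbabilityMeasure (stepLaw ℓ S β₀ η lam B w) :=
  isProbabilityMeasure_gaussian _ _

lemma stepLaw_congr {S S' : Fin n → Z} {B : Finset (Fin n)} (h : ∀ i ∈ B, S i = S' i)
    (β₀ η lam : ℝ) : stepLaw ℓ S β₀ η lam B = stepLaw ℓ S' β₀ η lam B := by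
  funext w
  rw [stepLaw, stepLaw, batchGradient_congr h]

lemma iterateLaw_congr {S S' : Fin n → Z} {M : ℕ → Finset (Fin n)} (β₀ : ℝ) (η lam : ℕ → ℝ)
    {k : ℕ} (h : ∀ j < k, ∀ i ∈ M (j + 2), S i = S' i) :
    iterateLaw ℓ S β₀ η lam M k = iterateLaw ℓ S' β₀ η lam M k := by
  induction k with
  | zero => rfl
  | succ k ih =>
    rw [iterateLaw, iterateLaw, ih fun j hj => h j (hj.trans k.lt_succ_self),
      stepLaw_congr (h k k.lt_succ_self)]

/-- The noise variance of the step from `w_{k+1}` to `w_{k+2}`, with `λη = 1 / (k + 2)`. -/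
lemma step_variance (β₀ : ℝ) {η : ℝ} (hη : 0 < η) (k : ℕ) :
    1 / (((k + 2 : ℕ) : ℝ) * η) * η * (2 - 1 / (((k + 2 : ℕ) : ℝ) * η) * η) * β₀
      = (2 * k + 3) / ((k : ℝ) + 2) ^ 2 * β₀ := by
  have : (0 : ℝ) < (k : ℝ) + 2 := by positivity
  push_cast
  field_simp
  ring

lemma step_variance_pos {β₀ η : ℝ} (hβ₀ : 0 < β₀) (hη : 0 < η) (k : ℕ) :
    0 < 1 / (((k + 2 : ℕ) : ℝ) * η) * η * (2 - 1 / (((k + 2 : ℕ) : ℝ) * η) * η) * β₀ := by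
  rw [step_variance β₀ hη]
  positivity

lemma step_contraction {η : ℝ} (hη : 0 < η) (k : ℕ) :
    1 - 1 / (((k + 2 : ℕ) : ℝ) * η) * η = ((k : ℝ) + 1) / ((k : ℝ) + 2) := by
  have : (0 : ℝ) < (k : ℝ) + 2 := by positivity
  push_cast
  field_simp
  ring

/-- `N + 1` iterations being performed, the variance of the noise injected after `w_{k+1}`,
divided by the square of the total contraction factor. -/
noncomputable def remainingVariance (β₀ : ℝ) (N k : ℕ) : ℝ :=
  (((N : ℝ) + 1) ^ 2 - ((k : ℝ) + 1) ^ 2) / ((k : ℝ) + 1) ^ 2 * β₀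

lemma remainingVariance_nonneg {β₀ : ℝ} (hβ₀ : 0 < β₀) {N k : ℕ} (hk : k ≤ N) :
    0 ≤ remainingVariance β₀ N k := by
  have : (k : ℝ) ≤ N := by exact_mod_cast hk
  have : 0 ≤ ((N : ℝ) + 1) ^ 2 - ((k : ℝ) + 1) ^ 2 := by
    rw [sub_nonneg]; gcongr
  unfold remainingVariance
  positivity

/-- The right side is c² times `remainingVariance β₀ N k` with c = (k+1)/(k+2), so this is the
backward recursion V_k = (V_{k+1} + v)/c². -/
lemma remainingVariance_succ_add (β₀ : ℝ) {η : ℝ} (hη : 0 < η) (N k : ℕ) :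
    remainingVariance β₀ N (k + 1)
      + 1 / (((k + 2 : ℕ) : ℝ) * η) * η * (2 - 1 / (((k + 2 : ℕ) : ℝ) * η) * η) * β₀
      = (((N : ℝ) + 1) ^ 2 - ((k : ℝ) + 1) ^ 2) / ((k : ℝ) + 2) ^ 2 * β₀ := by
  rw [step_variance β₀ hη, remainingVariance]
  push_cast
  field_simp
  ring

variable {L : ℝ≥0} {η β₀ α r : ℝ}

lemma measurable_step (hL : ∀ z, LipschitzWith L (gradient (fun w => ℓ w z)))
    (hη : 0 < η) (hβ₀ : 0 < β₀) (S : Fin n → Z) (B : Finset (Fin n)) (k : ℕ) :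
    Measurable (stepLaw ℓ S β₀ η (1 / (((k + 2 : ℕ) : ℝ) * η)) B) :=
  measurable_stepLaw (continuous_batchGradient hL S B) (step_variance_pos hβ₀ hη k).le

lemma lintegral_iterateLaw_succ (hL : ∀ z, LipschitzWith L (gradient (fun w => ℓ w z)))
    (hη : 0 < η) (hβ₀ : 0 < β₀) (S : Fin n → Z) (M : ℕ → Finset (Fin n)) (k : ℕ)
    {f : EuclideanSpace ℝ (Fin d) → ℝ≥0∞} (hf : Measurable f) :
    ∫⁻ x, f x ∂iterateLaw ℓ S β₀ (fun _ => η) (fun t => 1 / ((t : ℝ) * η)) M (k + 1)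
      = ∫⁻ w, ∫⁻ x, f x ∂stepLaw ℓ S β₀ η (1 / (((k + 2 : ℕ) : ℝ) * η)) (M (k + 2)) w
          ∂iterateLaw ℓ S β₀ (fun _ => η) (fun t => 1 / ((t : ℝ) * η)) M k :=
  Measure.lintegral_bind (measurable_step hL hη hβ₀ S _ k).aemeasurable hf.aemeasurable

lemma isProbabilityMeasure_iterateLaw (hL : ∀ z, LipschitzWith L (gradient (fun w => ℓ w z)))
    (hη : 0 < η) (hβ₀ : 0 < β₀) (S : Fin n → Z) (M : ℕ → Finset (Fin n)) (k : ℕ) :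
    IsProbabilityMeasure
      (iterateLaw ℓ S β₀ (fun _ => η) (fun t => 1 / ((t : ℝ) * η)) M k) := by
  induction k with
  | zero => exact isProbabilityMeasure_gaussian _ _
  | succ k ih =>
    constructor
    have h := lintegral_iterateLaw_succ hL hη hβ₀ S M k (f := fun _ => 1) measurable_const
    have := fun w => isProbabilityMeasure_stepLaw (ℓ := ℓ) S β₀ η (1 / (((k + 2 : ℕ) : ℝ) * η))
      (M (k + 2)) w
    simp only [lintegral_const, measure_univ, one_mul, mul_one] at h
    exact h

/-- Two copies of a step on the same mini-batch data, followed by dynamics satisfying a power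
Harnack inequality. -/
lemma PowerHarnack.step (hconv : ∀ z, ConvexOn ℝ Set.univ (fun w => ℓ w z))
    (hdiff : ∀ z, Differentiable ℝ (fun w => ℓ w z))
    (hL : ∀ z, LipschitzWith L (gradient (fun w => ℓ w z)))
    (hη : 0 < η) (hηL : η * L ≤ 2) (hβ₀ : 0 < β₀) (hr : r.HolderConjugate α)
    (S : Fin n → Z) (B : Finset (Fin n)) {N k : ℕ} (hk : k < N)
    {F Φ : EuclideanSpace ℝ (Fin d) → ℝ≥0∞} (hΦ : Measurable Φ)
    (h : PowerHarnack α r (remainingVariance β₀ N (k + 1)) F Φ) :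
    PowerHarnack α r (remainingVariance β₀ N k)
      (fun w => ∫⁻ x, F x ∂stepLaw ℓ S β₀ η (1 / (((k + 2 : ℕ) : ℝ) * η)) B w)
      (fun w => ∫⁻ x, Φ x ∂stepLaw ℓ S β₀ η (1 / (((k + 2 : ℕ) : ℝ) * η)) B w) := by
  intro x y _
  have hα1 : 0 < α - 1 := sub_pos.2 hr.symm.lt
  refine (h.lintegral_gaussian hr (remainingVariance_nonneg hβ₀ hk) (step_variance_pos hβ₀ hη k)
    hΦ _ ((1 - 1 / (((k + 2 : ℕ) : ℝ) * η) * η) • (y - η • batchGradient ℓ S B y))).trans ?_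
  refine mul_le_mul_left (ENNReal.ofReal_le_ofReal (Real.exp_le_exp.2
    (mul_le_mul_of_nonneg_left ?_ (half_pos hα1).le))) _
  rw [remainingVariance_succ_add β₀ hη, step_contraction hη, ← smul_sub, norm_smul, mul_pow,
    Real.norm_eq_abs, sq_abs]
  have hkN : (k : ℝ) < N := by exact_mod_cast hk
  have hpos : 0 < ((N : ℝ) + 1) ^ 2 - ((k : ℝ) + 1) ^ 2 := by
    rw [sub_pos]; gcongr
  have hs := norm_batch_step_sub_le hconv hdiff hL hη hηL S B x y
  set D := ‖(x - η • batchGradient ℓ S B x) - (y - η • batchGradient ℓ S B y)‖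
  calc (((k : ℝ) + 1) / (k + 2)) ^ 2 * D ^ 2
        / ((((N : ℝ) + 1) ^ 2 - ((k : ℝ) + 1) ^ 2) / ((k : ℝ) + 2) ^ 2 * β₀)
      ≤ (((k : ℝ) + 1) / (k + 2)) ^ 2 * ‖x - y‖ ^ 2
        / ((((N : ℝ) + 1) ^ 2 - ((k : ℝ) + 1) ^ 2) / ((k : ℝ) + 2) ^ 2 * β₀) := by gcongr
    _ = ‖x - y‖ ^ 2 / remainingVariance β₀ N k := by
        unfold remainingVariance
        field_simp

/-- If the data agree on all mini-batches used after `w_{k+1}`, the remaining dynamics satisfy a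
power Harnack inequality. -/
lemma exists_powerHarnack (hconv : ∀ z, ConvexOn ℝ Set.univ (fun w => ℓ w z))
    (hdiff : ∀ z, Differentiable ℝ (fun w => ℓ w z))
    (hL : ∀ z, LipschitzWith L (gradient (fun w => ℓ w z)))
    (hη : 0 < η) (hηL : η * L ≤ 2) (hβ₀ : 0 < β₀) (hr : r.HolderConjugate α)
    {S S' : Fin n → Z} {M : ℕ → Finset (Fin n)} {N k : ℕ} (hkN : k ≤ N)
    (hS : ∀ j, k ≤ j → j < N → ∀ i ∈ M (j + 2), S i = S' i)
    {f : EuclideanSpace ℝ (Fin d) → ℝ≥0∞} (hf : Measurable f) :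
    ∃ F Φ : EuclideanSpace ℝ (Fin d) → ℝ≥0∞, Measurable F ∧ Measurable Φ ∧
      PowerHarnack α r (remainingVariance β₀ N k) F Φ ∧
      ∫⁻ x, f x ∂iterateLaw ℓ S β₀ (fun _ => η) (fun t => 1 / ((t : ℝ) * η)) M N
        = ∫⁻ x, F x ∂iterateLaw ℓ S β₀ (fun _ => η) (fun t => 1 / ((t : ℝ) * η)) M k ∧
      ∫⁻ x, f x ^ r ∂iterateLaw ℓ S' β₀ (fun _ => η) (fun t => 1 / ((t : ℝ) * η)) M N
        = ∫⁻ x, Φ x ∂iterateLaw ℓ S' β₀ (fun _ => η) (fun t => 1 / ((t : ℝ) * η)) M k := by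
  refine Nat.decreasingInduction' (P := fun k => ∃ F Φ : EuclideanSpace ℝ (Fin d) → ℝ≥0∞,
      Measurable F ∧ Measurable Φ ∧ PowerHarnack α r (remainingVariance β₀ N k) F Φ ∧
      ∫⁻ x, f x ∂iterateLaw ℓ S β₀ (fun _ => η) (fun t => 1 / ((t : ℝ) * η)) M N
        = ∫⁻ x, F x ∂iterateLaw ℓ S β₀ (fun _ => η) (fun t => 1 / ((t : ℝ) * η)) M k ∧
      ∫⁻ x, f x ^ r ∂iterateLaw ℓ S' β₀ (fun _ => η) (fun t => 1 / ((t : ℝ) * η)) M N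
        = ∫⁻ x, Φ x ∂iterateLaw ℓ S' β₀ (fun _ => η) (fun t => 1 / ((t : ℝ) * η)) M k)
    ?_ hkN ?_
  · rintro j hjN hkj ⟨F, Φ, hF, hΦ, hH, hF', hΦ'⟩
    refine ⟨_, _, (Measure.measurable_lintegral hF).comp (measurable_step hL hη hβ₀ S (M (j + 2)) j),
      (Measure.measurable_lintegral hΦ).comp (measurable_step hL hη hβ₀ S' (M (j + 2)) j), ?_,
      hF'.trans (lintegral_iterateLaw_succ hL hη hβ₀ S M j hF),
      hΦ'.trans (lintegral_iterateLaw_succ hL hη hβ₀ S' M j hΦ)⟩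
    have := hH.step hconv hdiff hL hη hηL hβ₀ hr S (M (j + 2)) hjN hΦ
    -- The data agree on this batch, so both chains take this step with the same kernel.
    rw [← stepLaw_congr (hS j hkj hjN)]
    exact this
  -- No noise remains at k = N, so the Harnack inequality is only asked on the diagonal, where it is
  -- the equality f = (f^r)^(1/r).
  · refine ⟨f, fun x => f x ^ r, hf, by fun_prop, ?_, rfl, rfl⟩
    intro x y hxy
    obtain rfl := hxy (by simp [remainingVariance])
    simp [ENNReal.rpow_rpow_inv hr.pos.ne']

/-- The privacy bound for a fixed schedule of mini-batches, when the data differ only in a point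
used in the step from `w_{k+1}` to `w_{k+2}`. -/
lemma powerDominated_of_mem_batch {G : ℝ} (hconv : ∀ z, ConvexOn ℝ Set.univ (fun w => ℓ w z))
    (hdiff : ∀ z, Differentiable ℝ (fun w => ℓ w z))
    (hG : ∀ w z, ‖gradient (fun u => ℓ u z) w‖ ≤ G)
    (hL : ∀ z, LipschitzWith L (gradient (fun w => ℓ w z)))
    (hη : 0 < η) (hηL : η * L ≤ 2) (hβ₀ : 0 < β₀) (hr : r.HolderConjugate α)
    {S S' : Fin n → Z} {i : Fin n} (hi : ∀ j, j ≠ i → S j = S' j)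
    {M : ℕ → Finset (Fin n)} {N k : ℕ} (hk : k < N)
    (hM : ∀ j < N, j ≠ k → i ∉ M (j + 2))
    (hcard : ((N : ℝ) + 1) / (2 * ((N : ℝ) - k)) ≤ ((M (k + 2)).card : ℝ) ^ 2) :
    PowerDominated r
      (ENNReal.ofReal (Real.exp ((α - 1) / α * (2 * α * η ^ 2 * G ^ 2 / β₀))))
      (iterateLaw ℓ S β₀ (fun _ => η) (fun t => 1 / ((t : ℝ) * η)) M N)
      (iterateLaw ℓ S' β₀ (fun _ => η) (fun t => 1 / ((t : ℝ) * η)) M N) := by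
  intro f hf
  have hα : 0 < α := hr.symm.pos
  have hα1 : 0 < α - 1 := sub_pos.2 hr.symm.lt
  have hagree : ∀ j < N, j ≠ k → ∀ i' ∈ M (j + 2), S i' = S' i' :=
    fun j hj hjk i' hi' => hi i' fun e => hM j hj hjk (e ▸ hi')
  obtain ⟨F, Φ, hF, hΦ, hH, hF', hΦ'⟩ := exists_powerHarnack hconv hdiff hL hη hηL hβ₀ hr
    (S := S) (S' := S') (M := M) (N := N) (k := k + 1) hk
    (fun j hj hjN => hagree j hjN (by omega)) hf
  have hprob := isProbabilityMeasure_iterateLaw hL hη hβ₀ S' M k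
  have hlaw : iterateLaw ℓ S β₀ (fun _ => η) (fun t => 1 / ((t : ℝ) * η)) M k
      = iterateLaw ℓ S' β₀ (fun _ => η) (fun t => 1 / ((t : ℝ) * η)) M k :=
    iterateLaw_congr _ _ _ fun j hj => hagree j (hj.trans hk) hj.ne
  rw [hF', hΦ', lintegral_iterateLaw_succ hL hη hβ₀ S M k hF,
    lintegral_iterateLaw_succ hL hη hβ₀ S' M k hΦ, hlaw]
  set K := ENNReal.ofReal (Real.exp ((α - 1) / α * (2 * α * η ^ 2 * G ^ 2 / β₀)))
  set κ := stepLaw ℓ S β₀ η (1 / (((k + 2 : ℕ) : ℝ) * η)) (M (k + 2))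
  set κ' := stepLaw ℓ S' β₀ η (1 / (((k + 2 : ℕ) : ℝ) * η)) (M (k + 2))
  -- Both kernels start at the same w, so their means differ only through the batch gradients.
  have hpt : ∀ w, ∫⁻ x, F x ∂κ w ≤ K * (∫⁻ x, Φ x ∂κ' w) ^ (1 / r) := by
    intro w
    refine (hH.lintegral_gaussian hr (remainingVariance_nonneg hβ₀ hk)
      (step_variance_pos hβ₀ hη k) hΦ _ ((1 - 1 / (((k + 2 : ℕ) : ℝ) * η) * η) •
        (w - η • batchGradient ℓ S' (M (k + 2)) w))).trans ?_
    refine mul_le_mul_left (ENNReal.ofReal_le_ofReal (Real.exp_le_exp.2 ?_)) _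
    rw [remainingVariance_succ_add β₀ hη, step_contraction hη, ← smul_sub, norm_smul, mul_pow,
      Real.norm_eq_abs, sq_abs, sub_sub_sub_cancel_left, ← smul_sub, norm_smul,
      Real.norm_of_nonneg hη.le, norm_sub_rev]
    have hs := norm_batchGradient_sub_le hG hi (M (k + 2)) w
    set D := ‖batchGradient ℓ S (M (k + 2)) w - batchGradient ℓ S' (M (k + 2)) w‖
    set b : ℝ := ((M (k + 2)).card : ℝ)
    have hkN : (k : ℝ) < N := by exact_mod_cast hk
    have hNk : 0 < (N : ℝ) - k := sub_pos.2 hkN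
    have hpos : 0 < ((N : ℝ) + 1) ^ 2 - ((k : ℝ) + 1) ^ 2 := by
      rw [sub_pos]; gcongr
    have hb2 : 0 < b ^ 2 := lt_of_lt_of_le (by positivity) hcard
    have hb0 : b ≠ 0 := by rintro h0; simp [h0] at hb2
    -- The batch size enters here: (N+1)² - (k+1)² = (N-k)(N+k+2), so the right side is at least
    -- (N+1)(N+k+2)/2 ≥ (k+1)².
    have hb : ((k : ℝ) + 1) ^ 2 ≤ b ^ 2 * (((N : ℝ) + 1) ^ 2 - ((k : ℝ) + 1) ^ 2) := by
      refine le_trans ?_ (mul_le_mul_of_nonneg_right hcard hpos.le)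
      have e : ((N : ℝ) + 1) / (2 * ((N : ℝ) - k)) * (((N : ℝ) + 1) ^ 2 - ((k : ℝ) + 1) ^ 2)
          = ((N : ℝ) + 1) * ((N : ℝ) + k + 2) / 2 := by
        field_simp
        ring
      rw [e]
      have : (0 : ℝ) ≤ k := Nat.cast_nonneg k
      nlinarith
    have hD2 : D ^ 2 ≤ (b⁻¹ * (2 * G)) ^ 2 := by gcongr
    calc (α - 1) / 2 * ((((k : ℝ) + 1) / (k + 2)) ^ 2 * (η * D) ^ 2
          / ((((N : ℝ) + 1) ^ 2 - ((k : ℝ) + 1) ^ 2) / ((k : ℝ) + 2) ^ 2 * β₀))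
        = (α - 1) / 2 * (((k : ℝ) + 1) ^ 2 * η ^ 2
            / ((((N : ℝ) + 1) ^ 2 - ((k : ℝ) + 1) ^ 2) * β₀) * D ^ 2) := by
          field_simp
      _ ≤ (α - 1) / 2 * (((k : ℝ) + 1) ^ 2 * η ^ 2
            / ((((N : ℝ) + 1) ^ 2 - ((k : ℝ) + 1) ^ 2) * β₀) * (b⁻¹ * (2 * G)) ^ 2) := by
          gcongr
      _ = (((k : ℝ) + 1) ^ 2 / (b ^ 2 * (((N : ℝ) + 1) ^ 2 - ((k : ℝ) + 1) ^ 2)))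
            * (2 * (α - 1) * η ^ 2 * G ^ 2 / β₀) := by
          field_simp
      _ ≤ 1 * (2 * (α - 1) * η ^ 2 * G ^ 2 / β₀) := by
          refine mul_le_mul_of_nonneg_right ?_ (by positivity)
          exact div_le_one_of_le₀ hb (by positivity)
      _ = (α - 1) / α * (2 * α * η ^ 2 * G ^ 2 / β₀) := by
          field_simp
  have hmeas : Measurable fun w => ∫⁻ x, Φ x ∂κ' w :=
    (Measure.measurable_lintegral hΦ).comp (measurable_step hL hη hβ₀ S' (M (k + 2)) k)
  -- Averaging over the common law of w_{k+1} costs nothing, by Jensen for the concave r-th root.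
  calc ∫⁻ w, ∫⁻ x, F x ∂κ w ∂_ ≤ ∫⁻ w, K * (∫⁻ x, Φ x ∂κ' w) ^ (1 / r) ∂_ := lintegral_mono hpt
    _ = K * ∫⁻ w, (∫⁻ x, Φ x ∂κ' w) ^ (1 / r) ∂_ := lintegral_const_mul _ (hmeas.pow_const _)
    _ ≤ _ := by
        gcongr
        exact lintegral_rpow_inv_le hr _ hmeas

end Dynamics

end SGLD

/-! ### Random schedules and the privacy bound -/

theorem mainTheorem6 {d n T : ℕ} (hT : 1 ≤ T) {Z : Type*}
    (ℓ : EuclideanSpace ℝ (Fin d) → Z → ℝ) (G η β₀ α : ℝ) (L : NNReal)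
    (hconv : ∀ z, ConvexOn ℝ Set.univ (fun w => ℓ w z))
    (hdiff : ∀ z, Differentiable ℝ (fun w => ℓ w z))
    (hG : ∀ w z, ‖gradient (fun u => ℓ u z) w‖ ≤ G)
    (hL : ∀ z, LipschitzWith L (gradient (fun w => ℓ w z)))
    (hη : 0 < η) (hηL : η * (L : ℝ) ≤ 2) (hβ₀ : 0 < β₀) (hα : 1 < α)
    (P : PMF (SGLD.Schedule T n))
    (hP : ∀ M, P M ≠ 0 → M.IsSinglePass) :
    SGLD.IsRenyiDP α (2 * α * η ^ 2 * G ^ 2 / β₀)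
      (fun S : Fin n → Z =>
        SGLD.lastIterateLaw ℓ β₀ (fun _ => η) (fun t => 1 / ((t : ℝ) * η)) T P S) := by
  have hsum : ∑ M, P M = 1 := by rw [← tsum_fintype (L := .unconditional _), P.tsum_coe]
  have hprob : ∀ S : Fin n → Z, IsProbabilityMeasure
      (SGLD.lastIterateLaw ℓ β₀ (fun _ => η) (fun t => 1 / ((t : ℝ) * η)) T P S) := by
    intro S
    have := fun M : SGLD.Schedule T n => SGLD.isProbabilityMeasure_iterateLaw hL hη hβ₀ S M.batch (T - 1)
    constructor
    simp only [SGLD.lastIterateLaw, Measure.finsetSum_apply, Measure.smul_apply, measure_univ,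
      smul_eq_mul, mul_one, hsum]
  refine ⟨hprob, fun S S' hSS' => ?_⟩
  have hr : (α / (α - 1)).HolderConjugate α := (Real.HolderConjugate.conjExponent hα).symm
  have hS := hprob S
  have hS' := hprob S'
  refine SGLD.PowerDominated.renyiDiv_le hr (SGLD.PowerDominated.sum_smul hr hsum fun M hM => ?_)
  have hpass := hP M hM
  have hM' := SGLD.isProbabilityMeasure_iterateLaw hL hη hβ₀ S' M.batch (T - 1)
  have hα1 : 0 < α - 1 := sub_pos.2 hα
  have hK : 1 ≤ ENNReal.ofReal (Real.exp ((α - 1) / α * (2 * α * η ^ 2 * G ^ 2 / β₀))) := by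
    rw [ENNReal.one_le_ofReal, Real.one_le_exp_iff]
    positivity
  -- If this schedule never uses a differing item, the two output laws are equal.
  by_cases hused : ∃ k < T - 1, ∃ i ∈ M.batch (k + 2), S i ≠ S' i
  · obtain ⟨k, hk, i, hik, hi⟩ := hused
    have hone : ∀ j, j ≠ i → S j = S' j := by
      intro j hj
      by_contra hne
      exact hj ((Set.ncard_le_one_iff (Set.toFinite _)).1 hSS' hne hi)
    have hbatch : ∀ j < T - 1, ∃ h : j + 2 ∈ Finset.Icc 2 T, M.batch (j + 2) = M ⟨j + 2, h⟩ := by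
      intro j hj
      have h : j + 2 ∈ Finset.Icc 2 T := Finset.mem_Icc.2 ⟨by omega, by omega⟩
      exact ⟨h, by rw [SGLD.Schedule.batch, dif_pos h]⟩
    obtain ⟨hkT, hkM⟩ := hbatch k hk
    refine SGLD.powerDominated_of_mem_batch hconv hdiff hG hL hη hηL hβ₀ hr hone hk ?_ ?_
    · intro j hj hjk hij
      obtain ⟨hjT, hjM⟩ := hbatch j hj
      rw [hjM] at hij
      rw [hkM] at hik
      refine Finset.disjoint_left.1 (hpass.1 ⟨j + 2, hjT⟩ ⟨k + 2, hkT⟩ ?_) hij hik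
      simpa using hjk
    · rw [hkM, hpass.2 ⟨k + 2, hkT⟩]
      -- Index shift: N = T - 1 and t = k + 2, hence N - k = T - t + 1.
      have e : (((T - 1 : ℕ) : ℝ) + 1) / (2 * (((T - 1 : ℕ) : ℝ) - k))
          = (T : ℝ) / (2 * ((T : ℝ) - ((k + 2 : ℕ) : ℝ) + 1)) := by
        push_cast [Nat.cast_sub hT]
        ring_nf
      rw [e]
      exact (Real.sqrt_le_left (Nat.cast_nonneg _)).1 (Nat.le_ceil _)
  · push Not at hused
    rw [SGLD.iterateLaw_congr β₀ _ _ hused]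
    exact SGLD.powerDominated_self hr hK _
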